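/- Let $N\ge 1$, $X_1,\dots,X_N,Y,T>0$, $\sigma\in(0,2)$, $m\ge 1$, $\Omega=\prod_n(-X_n,X_n)\times(0,Y)$, $\Gamma_d=\prod_n[-X_n,X_n]\times\{0\}$, $\Gamma_h=\partial\Omega\setminus\Gamma_d$, and let $f\ge 0$ on $\prod_n[-X_n,X_n]$. Put $$L_\sigma v=\nabla\cdot(y^{1-\sigma}\nabla v),\qquad \frac{\partial v}{\partial y^\sigma}(x,0)=\mu_\sigma\lim_{y\to0^+}y^{1-\sigma}\frac{\partial v}{\partial y}(x,y),\qquad \mu_\sigma=\frac{2^{\sigma-1}\Gamma(\sigma/2)}{\Gamma(1-\sigma/2)},\qquad \nu_\sigma=\sigma\mu_\sigma .$$ Let $w\ge0$ be a classical solution (continuous on $\overline\Omega\times[0,T]$, and $C^2$ in $(x,y)\in\Omega$ for each $t\in(0,T]$) of $$\begin{cases}L_\sigma w=0, & (x,y)\in\Omega,\ t\in(0,T],\\ \dfrac{\partial w^{1/m}}{\partial t}(x,0,t)=\dfrac{\partial w}{\partial y^\sigma}(x,0,t), & (x,0)\in\Gamma_d,\ t\in(0,T],\\ w(x,0,0)=f(x)^m,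 & (x,0)\in\Gamma_d,\\ w(x,y,t)=0, & (x,y)\in\Gamma_h,\ t\in[0,T],\end{cases}$$ which is smooth in the following sense: $t\mapsto w(x,0,t)^{1/m}$ is $C^2$ on $[0,T]$ with second derivative bounded uniformly in $x$, and the derivatives $\partial^2 w/\partial x_n^2$ are bounded on $\Omega\times(0,T]$. Consider meshes of $\overline\Omega$ with the same step $\Delta x=2X_n/I_n=Y/K$ in all directions ($I_n,K\ge1$ integers), nodes $x_i=i\Delta x-X$, $y_k=k\Delta x$ (with $0\le i_n\le I_n$, $0\le k\le K$), and times $t_j=j\Delta t$, $\Delta t=T/J$, $0\le j\le J$, $J\ge1$. For a function $v$ on $\overline\Omega$ write $v_i^k=v(x_i,y_k)$, and write $(w_j)_i^k=w(x_i,y_k,t_j)$. Let $L^D_\sigma$ assign to every such mesh a linear operator on grid functions, and let it be a discretization of $L_\sigma$ of order $a\in\mathbb R$: for every regular enough function $v$ on $\overline\Omega$, $$\max_{(x_i,y_k)\in\Omega}|L^D_\sigma v_i^k-L_\sigma v(x_i,y_k)|\le C\,\Delta x^a\qquad\text{for all sufficiently small }\Delta x .$$ Here regularity is measured by some functional $v\mapsto\|v\|_{\mathrm{reg}}\in[0,\infty]$,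 "regular enough" means $\|v\|_{\mathrm{reg}}<\infty$, and $C$ and the smallness of $\Delta x$ depend on $v$ only through a bound on $\|v\|_{\mathrm{reg}}$. Assume that $w$ is regular enough uniformly in time, $\sup_{t\in(0,T]}\|w(\cdot,\cdot,t)\|_{\mathrm{reg}}<\infty$. For $0\le j<J$ define the local truncation error of the explicit scheme by $$(\tau_j)_i^k=\begin{cases}L^D_\sigma[(w_{j+1})_i^k], & 0<i_n<I_n\ \forall n,\ 0<k<K,\\[1mm] \nu_\sigma\dfrac{\Delta t}{\Delta x^\sigma}\big[(w_j)_i^1-(w_j)_i^0\big]+[(w_j)_i^0]^{1/m}-[(w_{j+1})_i^0]^{1/m}, & 0<i_n<I_n\ \forall n,\ k=0,\\[1mm] (w_{j+1})_i^k, & \text{at all other nodes},\end{cases}$$ and $\Lambda=\max_{i,k,j}|(\tau_j)_i^k|$. Then $$\Lambda=O\big(\Delta t(\Delta x^{2-\sigma}+\Delta t)+\Delta x^a\big),$$ that is, there is a constant $C>0$, independent of the mesh and of $J$, with $\Lambda\le C\big(\Delta t(\Delta x^{2-\sigma}+\Delta t)+\Delta x^a\big)$ for every such mesh and every $J\ge1$.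 -/

import Mathlib

open Set Filter Topology
open scoped ENNReal NNReal

noncomputable section

namespace FracPME

/-! ### The bounded domain -/

/-- The base box `(-X₁, X₁) × ⋯ × (-X_N, X_N)`. -/
def openBase {N : ℕ} (X : Fin N → ℝ) : Set (Fin N → ℝ) :=
  Set.univ.pi fun n => Ioo (-X n) (X n)

/-- The closed base box `[-X₁, X₁] × ⋯ × [-X_N, X_N]`. -/
def closedBase {N : ℕ} (X : Fin N → ℝ) : Set (Fin N → ℝ) :=
  Set.univ.pi fun n => Icc (-X n) (X n)

/-- The domain `Ω = (-X₁, X₁) × ⋯ × (-X_N, X_N) × (0, Y)`. -/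
def domain {N : ℕ} (X : Fin N → ℝ) (Y : ℝ) : Set ((Fin N → ℝ) × ℝ) :=
  openBase X ×ˢ Ioo 0 Y

/-- The base `Γ_d = [-X₁, X₁] × ⋯ × [-X_N, X_N] × {0}` of the boundary. -/
def bottomBdry {N : ℕ} (X : Fin N → ℝ) : Set ((Fin N → ℝ) × ℝ) :=
  closedBase X ×ˢ {0}

/-- The rest of the boundary, `Γ_h = ∂Ω \ Γ_d`. -/
def lateralBdry {N : ℕ} (X : Fin N → ℝ) (Y : ℝ) : Set ((Fin N → ℝ) × ℝ) :=
  frontier (domain X Y) \ bottomBdry X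

/-! ### The extension operator and the `σ`-derivative -/

/-- `∂v/∂x_n`. -/
def partialX {N : ℕ} (n : Fin N) (v : (Fin N → ℝ) → ℝ → ℝ) (x : Fin N → ℝ) (y : ℝ) : ℝ :=
  deriv (fun s => v (Function.update x n s) y) (x n)

/-- `∂v/∂y`. -/
def partialY {N : ℕ} (v : (Fin N → ℝ) → ℝ → ℝ) (x : Fin N → ℝ) (y : ℝ) : ℝ :=
  deriv (fun s => v x s) y

/-- `L_σ v = ∇ · (y^{1-σ} ∇ v)`, the divergence and the gradient taken in all variables `(x, y)`. -/
def extOp {N : ℕ} (σ : ℝ) (v : (Fin N → ℝ) → ℝ → ℝ) (x : Fin N → ℝ) (y : ℝ) : ℝ :=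
  (∑ n, partialX n (fun x' y' => y' ^ (1 - σ) * partialX n v x' y') x y)
    + partialY (fun x' y' => y' ^ (1 - σ) * partialY v x' y') x y

/-- `μ_σ = 2^{σ-1} Γ(σ/2) / Γ(1-σ/2)`. -/
def muSigma (σ : ℝ) : ℝ := 2 ^ (σ - 1) * Real.Gamma (σ / 2) / Real.Gamma (1 - σ / 2)

/-- `ν_σ = σ μ_σ`. -/
def nuSigma (σ : ℝ) : ℝ := σ * muSigma σ

/-- The `σ`-derivative `∂v/∂y^σ (x, 0) = μ_σ lim_{y → 0⁺} y^{1-σ} ∂v/∂y (x, y)` exists and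
equals `d`. -/
def HasSigmaDeriv {N : ℕ} (σ : ℝ) (v : (Fin N → ℝ) → ℝ → ℝ) (x : Fin N → ℝ) (d : ℝ) : Prop :=
  Tendsto (fun y => muSigma σ * (y ^ (1 - σ) * partialY v x y)) (𝓝[>] 0) (𝓝 d)

/-! ### The extension problem in the bounded domain -/

/-- `w` is a (nonnegative) classical solution of the extension problem in `Ω × [0, T]` with
initial datum `f ^ m` on the base. -/
structure IsSolution {N : ℕ} (X : Fin N → ℝ) (Y T σ m : ℝ) (f : (Fin N → ℝ) → ℝ)
    (w : (Fin N → ℝ) → ℝ → ℝ → ℝ) : Prop where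
  continuousOn : ContinuousOn (fun p : (Fin N → ℝ) × ℝ × ℝ => w p.1 p.2.1 p.2.2)
    (closedBase X ×ˢ Icc 0 Y ×ˢ Icc 0 T)
  nonneg : ∀ x ∈ closedBase X, ∀ y ∈ Icc 0 Y, ∀ t ∈ Icc 0 T, 0 ≤ w x y t
  contDiffOn : ∀ t ∈ Ioc 0 T,
    ContDiffOn ℝ 2 (fun p : (Fin N → ℝ) × ℝ => w p.1 p.2 t) (domain X Y)
  extension : ∀ t ∈ Ioc 0 T, ∀ p ∈ domain X Y, extOp σ (fun x y => w x y t) p.1 p.2 = 0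
  evolution : ∀ t ∈ Ioc 0 T, ∀ x ∈ closedBase X, ∃ d : ℝ,
    HasDerivWithinAt (fun s => w x 0 s ^ (1 / m)) d (Icc 0 T) t ∧
      HasSigmaDeriv σ (fun x y => w x y t) x d
  initial : ∀ x ∈ closedBase X, w x 0 0 = f x ^ m
  lateral : ∀ t ∈ Icc 0 T, ∀ p ∈ lateralBdry X Y, w p.1 p.2 t = 0

/-- The smoothness of the solution: `u = w^{1/m}` is `C²` in `t` on the base, with bounded
second derivative, and the second `x` derivatives of `u^m = w` (which exist and are continuous in
`Ω`, since a solution is `C²` there) are bounded. (Nothing is asked about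
derivatives in `y` up to `y = 0`, where solutions behave like `y^σ`.) -/
structure IsSmooth {N : ℕ} (X : Fin N → ℝ) (Y T m : ℝ)
    (w : (Fin N → ℝ) → ℝ → ℝ → ℝ) : Prop where
  time_contDiffOn : ∀ x ∈ closedBase X, ContDiffOn ℝ 2 (fun t => w x 0 t ^ (1 / m)) (Icc 0 T)
  time_bound : ∃ B : ℝ, ∀ x ∈ closedBase X, ∀ t ∈ Icc 0 T,
    |iteratedDerivWithin 2 (fun s => w x 0 s ^ (1 / m)) (Icc 0 T) t| ≤ B
  space_bound : ∃ B : ℝ, ∀ t ∈ Ioc 0 T, ∀ p ∈ domain X Y, ∀ n,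
    |partialX n (partialX n fun x y => w x y t) p.1 p.2| ≤ B

/-! ### The mesh and the discrete operator -/

/-- A uniform mesh of the closure of `Ω`: `I n` steps in the direction `x_n` and `K` steps in the
direction `y`, all of the same length. -/
structure Mesh {N : ℕ} (X : Fin N → ℝ) (Y : ℝ) where
  I : Fin N → ℕ
  K : ℕ
  I_pos : ∀ n, 0 < I n
  K_pos : 0 < K
  uniform : ∀ n, 2 * X n / I n = Y / K

namespace Mesh

variable {N : ℕ} {X : Fin N → ℝ} {Y : ℝ} (M : Mesh X Y)

/-- The mesh width `Δx = Δy`. -/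
def dx : ℝ := Y / M.K

/-- Multi-indices `i` of nodes in the `x` directions, `0 ≤ i n ≤ I n`. -/
abbrev XIndex : Type := (n : Fin N) → Fin (M.I n + 1)

/-- Indices `k` of nodes in the `y` direction, `0 ≤ k ≤ K`. -/
abbrev YIndex : Type := Fin (M.K + 1)

/-- Functions on the nodes of the mesh. -/
abbrev GridFun : Type := M.XIndex → M.YIndex → ℝ

/-- `x_i = i Δx - X`. -/
def xNode (i : M.XIndex) : Fin N → ℝ := fun n => ((i n : ℕ) : ℝ) * M.dx - X n

/-- `y_k = k Δx`. -/
def yNode (k : ℕ) : ℝ := (k : ℝ) * M.dx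

/-- The values `v_i^k = v(x_i, y_k)` of a function at the nodes. -/
def restrict (v : (Fin N → ℝ) → ℝ → ℝ) : M.GridFun := fun i k => v (M.xNode i) (M.yNode k)

/-- `0 < i n < I n` in every direction. -/
abbrev XInterior (i : M.XIndex) : Prop := ∀ n, 0 < (i n : ℕ) ∧ (i n : ℕ) < M.I n

/-- The node `(x_i, y_k)` lies in `Ω`. -/
abbrev Interior (i : M.XIndex) (k : M.YIndex) : Prop :=
  M.XInterior i ∧ 0 < (k : ℕ) ∧ (k : ℕ) < M.K

end Mesh

/-- A discrete operator: on each mesh a linear operator on grid functions (only its values at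
interior nodes will matter). -/
abbrev DiscreteOp {N : ℕ} (X : Fin N → ℝ) (Y : ℝ) : Type :=
  (M : Mesh X Y) → M.GridFun →ₗ[ℝ] M.GridFun

/-- `LD` is a discretization of order `a` of `L_σ`: for every regular enough `v`,
`max_{i,k} |LD v_i^k - L_σ v(x_i, y_k)| = O(Δx^a)` as `Δx → 0`. The regularity of `v` is measured
by `reg v` (for instance a norm of some function space, `∞` off that space); `v` is
regular enough if `reg v < ∞`, and the constant depends on `v` only through a bound on `reg v`. -/
def HasOrder {N : ℕ} {X : Fin N → ℝ} {Y : ℝ} (σ : ℝ) (LD : DiscreteOp X Y) (a : ℝ)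
    (reg : ((Fin N → ℝ) → ℝ → ℝ) → ℝ≥0∞) : Prop :=
  ∀ R : ℝ≥0, ∃ C δ : ℝ, 0 < δ ∧ ∀ v, reg v ≤ R → ∀ M : Mesh X Y, M.dx < δ →
    ∀ i k, M.Interior i k →
      |LD M (M.restrict v) i k - extOp σ v (M.xNode i) (M.yNode k)| ≤ C * M.dx ^ a

/-! ### The local truncation error -/

section Truncation

variable {N : ℕ} {X : Fin N → ℝ} {Y : ℝ}

/-- The time step `Δt = T / J`. -/
def dt (T : ℝ) (J : ℕ) : ℝ := T / J

/-- The local truncation error `(τ_j)_i^k` of the step from `t_j` to `t_{j+1}`: what is left when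
the values of `w` at the nodes are put into the equations of the explicit scheme.
* interior nodes: `LD [(w_{j+1})_i^k]`;
* base nodes: `ν_σ Δt/Δx^σ ((w_j)_i^1 - (w_j)_i^0) + ((w_j)_i^0)^{1/m} - ((w_{j+1})_i^0)^{1/m}`;
* remaining boundary nodes: `(w_{j+1})_i^k`. -/
def truncError (T σ m : ℝ) (LD : DiscreteOp X Y) (w : (Fin N → ℝ) → ℝ → ℝ → ℝ)
    (M : Mesh X Y) (J : ℕ) (j : ℕ) (i : M.XIndex) (k : M.YIndex) : ℝ :=
  if M.Interior i k then
    LD M (M.restrict fun x y => w x y ((j + 1 : ℕ) * dt T J)) i k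
  else if M.XInterior i ∧ (k : ℕ) = 0 then
    nuSigma σ * (dt T J / M.dx ^ σ) *
        (w (M.xNode i) (M.yNode 1) (j * dt T J) - w (M.xNode i) (M.yNode 0) (j * dt T J))
      + w (M.xNode i) (M.yNode 0) (j * dt T J) ^ (1 / m)
      - w (M.xNode i) (M.yNode 0) ((j + 1 : ℕ) * dt T J) ^ (1 / m)
  else
    w (M.xNode i) (M.yNode k) ((j + 1 : ℕ) * dt T J)

/-- `Λ = max_{i,k,j} |(τ_j)_i^k|`, over all nodes and all steps `j = 0, …, J - 1`. -/
def maxTruncError (T σ m : ℝ) (LD : DiscreteOp X Y) (w : (Fin N → ℝ) → ℝ → ℝ → ℝ)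
    (M : Mesh X Y) (J : ℕ) [NeZero J] : ℝ :=
  (Finset.univ : Finset (M.XIndex × M.YIndex × Fin J)).sup' Finset.univ_nonempty
    fun q => |truncError T σ m LD w M J q.2.2 q.1 q.2.1|

end Truncation

end FracPME

end

open Set Filter Topology
open scoped ENNReal NNReal

namespace FracPME


/-! The three kinds of nodes are treated separately. Nodes outside `Ω` and off the relative interior
of the base contribute nothing, because `w` vanishes there.

At base nodes the equation reads `(y^{1-σ} w_y)_y = -y^{1-σ} Δ_x w = O(y^{1-σ})`. Integrating twice
from `y = 0` (`abs_sub_sigma_expansion_le`) gives `w(x,y) = w(x,0) + (∂w/∂y^σ) y^σ/ν_σ + O(y²)`,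
with no regularity in `y` assumed up to the base. At `y = Δx`, multiplying by `ν_σ Δt/Δx^σ` leaves
`Δt ∂w/∂y^σ + O(Δt Δx^{2-σ})`. The main term is `Δt ∂_t w^{1/m}`, which cancels the time increment
up to `O(Δt²)` by `abs_taylor_one_le`.

At interior nodes `L_σ w = 0`, so the truncation error is the consistency error, `O(Δx^a)` on fine
meshes. Only finitely many meshes are coarse, and on each a linear operator is bounded on bounded
grid functions (`exists_bound_coarse_mesh`), so the constant serves every mesh. -/

/-! ### One-dimensional estimates -/

/-- If `|f'| ≤ B'` on `(0, Y)`, then the increments of `f` from the right limit at `0` are bounded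
by those of `B`. -/
theorem abs_sub_le_of_abs_deriv_le {f f' B B' : ℝ → ℝ} {Y l b : ℝ}
    (hf : ∀ y ∈ Ioo 0 Y, HasDerivAt f (f' y) y) (hB : ∀ y ∈ Ioo 0 Y, HasDerivAt B (B' y) y)
    (hle : ∀ y ∈ Ioo 0 Y, |f' y| ≤ B' y)
    (hfl : Tendsto f (𝓝[>] 0) (𝓝 l)) (hBb : Tendsto B (𝓝[>] 0) (𝓝 b))
    {y : ℝ} (hy : y ∈ Ioo 0 Y) : |f y - l| ≤ B y - b := by
  -- The mean value inequality is anchored at `ε > 0`, since `f` is controlled at `0` only through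
  -- its limit; then `ε → 0`.
  have key : ∀ ε ∈ Ioo 0 y, |f y - f ε| ≤ B y - B ε := by
    intro ε hε
    have hsub : ∀ z ∈ Icc ε y, z ∈ Ioo 0 Y := fun z hz =>
      ⟨hε.1.trans_le hz.1, hz.2.trans_lt hy.2⟩
    have := image_norm_le_of_norm_deriv_right_le_deriv_boundary' (f := fun z => f z - f ε)
      (f' := f') (a := ε) (b := y) (B := fun z => B z - B ε) (B' := B')
      (fun z hz => (((hf z (hsub z hz)).sub_const _).continuousAt).continuousWithinAt)
      (fun z hz => ((hf z (hsub z (Ico_subset_Icc_self hz))).sub_const _).hasDerivWithinAt)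
      (by simp)
      (fun z hz => (((hB z (hsub z hz)).sub_const _).continuousAt).continuousWithinAt)
      (fun z hz => ((hB z (hsub z (Ico_subset_Icc_self hz))).sub_const _).hasDerivWithinAt)
      (fun z hz => hle z (hsub z (Ico_subset_Icc_self hz)))
      (right_mem_Icc.2 hε.2.le)
    simpa using this
  refine le_of_tendsto_of_tendsto ((tendsto_const_nhds.sub hfl).abs)
    (tendsto_const_nhds.sub hBb) ?_
  filter_upwards [Ioo_mem_nhdsGT hy.1] with ε hε using key ε hε

/-- A positive power tends to `0` at `0` from the right. -/
theorem tendsto_rpow_nhdsGT_zero {p : ℝ} (hp : 0 < p) :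
    Tendsto (fun y : ℝ => y ^ p) (𝓝[>] 0) (𝓝 0) := by
  have h := (Real.continuousAt_rpow_const 0 p (Or.inr hp.le)).tendsto
  rw [Real.zero_rpow hp.ne'] at h
  exact h.mono_left nhdsWithin_le_nhds

/-- Expansion at the origin of a function `φ` for which `(y^{1-σ} φ')' = O(y^{1-σ})`: it agrees
with `φ(0) + g₀ y^σ / σ` up to `O(y²)`, where `g₀ = lim y^{1-σ} φ'`. -/
theorem abs_sub_sigma_expansion_le {σ Y c g₀ : ℝ} (hσ : σ ∈ Ioo (0 : ℝ) 2) (hY : 0 < Y)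
    {φ φ' ψ : ℝ → ℝ} (hcont : ContinuousOn φ (Icc 0 Y))
    (hφ : ∀ y ∈ Ioo 0 Y, HasDerivAt φ (φ' y) y)
    (hψ : ∀ y ∈ Ioo 0 Y, HasDerivAt (fun s => s ^ (1 - σ) * φ' s) (ψ y) y)
    (hle : ∀ y ∈ Ioo 0 Y, |ψ y| ≤ c * y ^ (1 - σ))
    (hlim : Tendsto (fun s => s ^ (1 - σ) * φ' s) (𝓝[>] 0) (𝓝 g₀))
    {y : ℝ} (hy : y ∈ Ioc 0 Y) :
    |φ y - φ 0 - g₀ * (y ^ σ / σ)| ≤ c / (2 * (2 - σ)) * y ^ 2 := by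
  obtain ⟨hσ0, hσ2⟩ := hσ
  have h2σ : 0 < 2 - σ := by linarith
  -- First integration, of the flux: `c s^{1-σ}` is integrable at `0` because `σ < 2`.
  have hflux : ∀ y ∈ Ioo 0 Y,
      |y ^ (1 - σ) * φ' y - g₀| ≤ c / (2 - σ) * y ^ (2 - σ) := by
    intro y hy
    have hB : ∀ z ∈ Ioo 0 Y,
        HasDerivAt (fun s : ℝ => c / (2 - σ) * s ^ (2 - σ)) (c * z ^ (1 - σ)) z := by
      intro z hz
      have := (Real.hasDerivAt_rpow_const (x := z) (p := 2 - σ) (Or.inl hz.1.ne')).const_mul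
        (c / (2 - σ))
      refine this.congr_deriv ?_
      rw [show 2 - σ - 1 = 1 - σ by ring]
      field_simp
    have hB0 : Tendsto (fun s : ℝ => c / (2 - σ) * s ^ (2 - σ)) (𝓝[>] 0) (𝓝 0) := by
      simpa using (tendsto_rpow_nhdsGT_zero h2σ).const_mul (c / (2 - σ))
    simpa using abs_sub_le_of_abs_deriv_le hψ hB hle hlim hB0 hy
  -- Second integration: dividing the flux bound by `s^{1-σ}` leaves `c/(2-σ) * s`.
  have hopen : ∀ y ∈ Ioo 0 Y,
      |φ y - φ 0 - g₀ * (y ^ σ / σ)| ≤ c / (2 * (2 - σ)) * y ^ 2 := by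
    intro y hy
    have hf : ∀ z ∈ Ioo 0 Y, HasDerivAt (fun s : ℝ => φ s - g₀ * (s ^ σ / σ))
        (φ' z - g₀ * z ^ (σ - 1)) z := by
      intro z hz
      have h1 := ((Real.hasDerivAt_rpow_const (x := z) (p := σ) (Or.inl hz.1.ne')).div_const
        σ).const_mul g₀
      refine ((hφ z hz).sub h1).congr_deriv ?_
      field_simp
    have hB : ∀ z ∈ Ioo 0 Y, HasDerivAt (fun s : ℝ => c / (2 * (2 - σ)) * s ^ 2)
        (c / (2 - σ) * z) z := by
      intro z hz
      refine ((hasDerivAt_pow 2 z).const_mul (c / (2 * (2 - σ)))).congr_deriv ?_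
      simp only [Nat.cast_ofNat, Nat.add_one_sub_one, pow_one]
      field_simp
    have hle' : ∀ z ∈ Ioo 0 Y, |φ' z - g₀ * z ^ (σ - 1)| ≤ c / (2 - σ) * z := by
      intro z hz
      have hp : 0 < z ^ (σ - 1) := Real.rpow_pos_of_pos hz.1 _
      have e1 : z ^ (σ - 1) * z ^ (1 - σ) = 1 := by
        rw [← Real.rpow_add hz.1]; simp
      have e2 : z ^ (σ - 1) * z ^ (2 - σ) = z := by
        rw [← Real.rpow_add hz.1, show σ - 1 + (2 - σ) = 1 by ring, Real.rpow_one]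
      have e : φ' z - g₀ * z ^ (σ - 1) = z ^ (σ - 1) * (z ^ (1 - σ) * φ' z - g₀) := by
        linear_combination (-φ' z) * e1
      rw [e, abs_mul, abs_of_pos hp]
      calc z ^ (σ - 1) * |z ^ (1 - σ) * φ' z - g₀|
          ≤ z ^ (σ - 1) * (c / (2 - σ) * z ^ (2 - σ)) := by gcongr; exact hflux z hz
        _ = c / (2 - σ) * z := by linear_combination (c / (2 - σ)) * e2
    have hφ0 : Tendsto φ (𝓝[>] 0) (𝓝 (φ 0)) :=
      ((hcont 0 (left_mem_Icc.2 hY.le)).mono_of_mem_nhdsWithin (Icc_mem_nhdsGT hY)).tendsto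
    have hl : Tendsto (fun s : ℝ => φ s - g₀ * (s ^ σ / σ)) (𝓝[>] 0) (𝓝 (φ 0)) := by
      simpa using hφ0.sub (((tendsto_rpow_nhdsGT_zero hσ0).div_const σ).const_mul g₀)
    have hB0 : Tendsto (fun s : ℝ => c / (2 * (2 - σ)) * s ^ 2) (𝓝[>] 0) (𝓝 0) := by
      have : ContinuousAt (fun s : ℝ => c / (2 * (2 - σ)) * s ^ 2) 0 := by fun_prop
      simpa using this.tendsto.mono_left nhdsWithin_le_nhds
    have := abs_sub_le_of_abs_deriv_le hf hB hle' hl hB0 hy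
    rwa [sub_zero, sub_right_comm] at this
  -- The endpoint `y = Y` is needed when the mesh has a single step in `y`; it follows by left
  -- continuity.
  rcases hy.2.lt_or_eq with h | rfl
  · exact hopen y ⟨hy.1, h⟩
  · have hφY : Tendsto φ (𝓝[<] y) (𝓝 (φ y)) :=
      ((hcont y (right_mem_Icc.2 hY.le)).mono_of_mem_nhdsWithin (Icc_mem_nhdsLT hY)).tendsto
    have hpow : Tendsto (fun s : ℝ => s ^ σ) (𝓝[<] y) (𝓝 (y ^ σ)) :=
      (Real.continuousAt_rpow_const y σ (Or.inl hY.ne')).tendsto.mono_left nhdsWithin_le_nhds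
    have hsq : Tendsto (fun s : ℝ => s ^ 2) (𝓝[<] y) (𝓝 (y ^ 2)) :=
      (continuous_pow 2).continuousAt.tendsto.mono_left nhdsWithin_le_nhds
    refine le_of_tendsto_of_tendsto
      (((hφY.sub_const (φ 0)).sub ((hpow.div_const σ).const_mul g₀)).abs)
      (hsq.const_mul _) ?_
    filter_upwards [Ioo_mem_nhdsLT hY] with s hs using hopen s hs

/-- First order Taylor expansion inside an interval, with a bound on the second derivative. -/
theorem abs_taylor_one_le {T B : ℝ} (hT : 0 < T) {u : ℝ → ℝ} (hu : ContDiffOn ℝ 2 u (Icc 0 T))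
    (hB : ∀ t ∈ Icc 0 T, |iteratedDerivWithin 2 u (Icc 0 T) t| ≤ B)
    {s t : ℝ} (hs : 0 ≤ s) (hst : s ≤ t) (ht : t ≤ T) :
    |u t - u s - (t - s) * derivWithin u (Icc 0 T) s| ≤ B * (t - s) ^ 2 := by
  have hU : UniqueDiffOn ℝ (Icc 0 T) := uniqueDiffOn_Icc hT
  have hd1 : DifferentiableOn ℝ (derivWithin u (Icc 0 T)) (Icc 0 T) :=
    (hu.derivWithin hU (m := 1) (by norm_num)).differentiableOn (by norm_num)
  have hd0 : DifferentiableOn ℝ u (Icc 0 T) := hu.differentiableOn (by norm_num)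
  have hsT : s ∈ Icc 0 T := ⟨hs, hst.trans ht⟩
  have hB0 : 0 ≤ B := (abs_nonneg _).trans (hB s hsT)
  have hlip : ∀ r ∈ Icc s t,
      |derivWithin u (Icc 0 T) r - derivWithin u (Icc 0 T) s| ≤ B * (t - s) := by
    intro r hr
    have hrT : r ∈ Icc 0 T := ⟨hs.trans hr.1, hr.2.trans ht⟩
    have h := (convex_Icc (0 : ℝ) T).norm_image_sub_le_of_norm_derivWithin_le hd1
      (C := B) (fun x hx => by
        have := hB x hx
        rwa [iteratedDerivWithin_succ, iteratedDerivWithin_one] at this) hsT hrT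
    rw [Real.norm_eq_abs, Real.norm_eq_abs, abs_of_nonneg (sub_nonneg.2 hr.1)] at h
    exact h.trans (by gcongr; exact hr.2)
  have hsub : Icc s t ⊆ Icc 0 T := Icc_subset_Icc hs ht
  -- Subtracting the tangent slope lets the mean value inequality apply a second time; this crude
  -- route gives `B` in place of `B / 2`.
  have h := (convex_Icc s t).norm_image_sub_le_of_norm_hasDerivWithin_le
    (f := fun r => u r - r * derivWithin u (Icc 0 T) s)
    (f' := fun r => derivWithin u (Icc 0 T) r - derivWithin u (Icc 0 T) s)
    (C := B * (t - s))
    (fun r hr => by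
      have h1 := ((hd0 r (hsub hr)).hasDerivWithinAt).mono hsub
      exact (h1.sub ((hasDerivWithinAt_id r _).mul_const
        (derivWithin u (Icc 0 T) s))).congr_deriv (by simp))
    hlip (left_mem_Icc.2 hst) (right_mem_Icc.2 hst)
  rw [Real.norm_eq_abs, Real.norm_eq_abs, abs_of_nonneg (sub_nonneg.2 hst)] at h
  convert h using 1
  · congr 1; ring
  · ring


theorem muSigma_pos {σ : ℝ} (hσ : σ ∈ Ioo (0 : ℝ) 2) : 0 < muSigma σ := by
  have h1 := Real.Gamma_pos_of_pos (s := σ / 2) (by linarith [hσ.1])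
  have h2 := Real.Gamma_pos_of_pos (s := 1 - σ / 2) (by linarith [hσ.2])
  unfold muSigma
  positivity

/-! ### Geometry of the mesh -/

namespace Mesh

variable {N : ℕ} {X : Fin N → ℝ} {Y : ℝ} (M : Mesh X Y)

theorem dx_pos (hY : 0 < Y) : 0 < M.dx :=
  div_pos hY (Nat.cast_pos.2 M.K_pos)

theorem dx_le (hY : 0 < Y) : M.dx ≤ Y :=
  div_le_self hY.le (by exact_mod_cast M.K_pos)

theorem K_mul_dx : (M.K : ℝ) * M.dx = Y := by
  have : (M.K : ℝ) ≠ 0 := by exact_mod_cast M.K_pos.ne'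
  unfold dx
  field_simp

theorem I_mul_dx (n : Fin N) : (M.I n : ℝ) * M.dx = 2 * X n := by
  have : (M.I n : ℝ) ≠ 0 := by exact_mod_cast (M.I_pos n).ne'
  unfold dx
  rw [← M.uniform n]
  field_simp

theorem xNode_mem_closedBase (hY : 0 < Y) (i : M.XIndex) : M.xNode i ∈ closedBase X := by
  intro n _
  have hd := M.dx_pos hY
  have h1 : (0 : ℝ) ≤ (i n : ℕ) * M.dx := by positivity
  have h2 : ((i n : ℕ) : ℝ) * M.dx ≤ M.I n * M.dx := by
    gcongr
    exact Nat.lt_succ_iff.1 (i n).2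
  rw [M.I_mul_dx n] at h2
  constructor <;> simp only [xNode] <;> linarith

theorem xNode_mem_openBase_iff (hY : 0 < Y) (i : M.XIndex) :
    M.xNode i ∈ openBase X ↔ M.XInterior i := by
  have hd := M.dx_pos hY
  simp only [openBase, Set.mem_univ_pi, xNode, mem_Ioo]
  refine forall_congr' fun n => and_congr ?_ ?_
  · rw [neg_lt_sub_iff_lt_add, lt_add_iff_pos_right, mul_pos_iff_of_pos_right hd, Nat.cast_pos]
  · rw [sub_lt_iff_lt_add, ← two_mul, ← M.I_mul_dx n, mul_lt_mul_iff_left₀ hd, Nat.cast_lt]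

theorem yNode_mem_Icc (hY : 0 < Y) (k : M.YIndex) : M.yNode k ∈ Icc 0 Y := by
  have hd := M.dx_pos hY
  refine ⟨by unfold yNode; positivity, ?_⟩
  calc M.yNode k ≤ M.K * M.dx := by
        unfold yNode
        gcongr
        exact Nat.lt_succ_iff.1 k.2
    _ = Y := M.K_mul_dx

theorem yNode_mem_Ioo_iff (hY : 0 < Y) (k : M.YIndex) :
    M.yNode k ∈ Ioo 0 Y ↔ 0 < (k : ℕ) ∧ (k : ℕ) < M.K := by
  have hd := M.dx_pos hY
  have h := M.K_mul_dx
  simp only [yNode, mem_Ioo]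
  refine and_congr ?_ ?_
  · rw [mul_pos_iff_of_pos_right hd, Nat.cast_pos]
  · have e : ((k : ℕ) : ℝ) * M.dx < M.K * M.dx ↔ (k : ℕ) < M.K := by
      rw [mul_lt_mul_iff_left₀ hd, Nat.cast_lt]
    rwa [h] at e

theorem mem_domain_iff (hY : 0 < Y) (i : M.XIndex) (k : M.YIndex) :
    (M.xNode i, M.yNode k) ∈ domain X Y ↔ M.Interior i k :=
  and_congr (M.xNode_mem_openBase_iff hY i) (M.yNode_mem_Ioo_iff hY k)

/-- A mesh is determined by its number of steps in the direction `y`. -/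
theorem K_injective (hY : 0 < Y) : Function.Injective (K : Mesh X Y → ℕ) := by
  intro M M' h
  -- `K` fixes the common width `Y / K`, and the width fixes each `I n = 2 X n / dx`.
  have hI : M.I = M'.I := by
    funext n
    have hd : M.dx = M'.dx := by unfold dx; rw [h]
    have h1 := M.I_mul_dx n
    rw [← M'.I_mul_dx n, hd] at h1
    exact_mod_cast mul_right_cancel₀ (M'.dx_pos hY).ne' h1
  cases M
  cases M'
  subst h hI
  rfl

/-- Only finitely many meshes are coarser than a given width. -/
theorem finite_setOf_le_dx (hY : 0 < Y) {δ : ℝ} (hδ : 0 < δ) :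
    {M : Mesh X Y | δ ≤ M.dx}.Finite := by
  refine Set.Finite.of_injOn (f := K) (t := Iic ⌊Y / δ⌋₊) ?_ (K_injective hY).injOn
    (Set.finite_Iic _)
  intro M hM
  refine Nat.le_floor ?_
  rw [le_div_iff₀ hδ]
  exact (mul_le_mul_of_nonneg_left hM (Nat.cast_nonneg _)).trans_eq M.K_mul_dx

end Mesh

/-! ### The domain and the interior nodes -/

variable {N : ℕ} {X : Fin N → ℝ} {Y : ℝ}

theorem isOpen_domain : IsOpen (domain X Y) :=
  (isOpen_set_pi finite_univ fun _ _ => isOpen_Ioo).prod isOpen_Ioo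

theorem closure_domain (hX : ∀ n, 0 < X n) (hY : 0 < Y) :
    closure (domain X Y) = closedBase X ×ˢ Icc 0 Y := by
  unfold domain openBase closedBase
  rw [closure_prod_eq, closure_pi_set, closure_Ioo hY.ne]
  congr 1
  refine Set.pi_congr rfl fun n _ => closure_Ioo ?_
  linarith [hX n]

/-- Uniform bound for a family of discrete operators on bounded grid functions, over all coarse
meshes. -/
theorem exists_bound_coarse_mesh (hY : 0 < Y) (LD : DiscreteOp X Y) (a W : ℝ) {δ : ℝ}
    (hδ : 0 < δ) : ∃ D : ℝ, ∀ M : Mesh X Y, δ ≤ M.dx → ∀ g : M.GridFun,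
      (∀ i k, |g i k| ≤ W) → ∀ i k, |LD M g i k| ≤ D * M.dx ^ a := by
  -- Dividing by `dx ^ a` before taking the maximum over finitely many meshes avoids any case split
  -- on the sign of `a`.
  obtain ⟨D, hD⟩ := ((Mesh.finite_setOf_le_dx (X := X) hY hδ).image fun M =>
    ‖(LD M).toContinuousLinearMap‖ * W / M.dx ^ a).bddAbove
  refine ⟨D, fun M hM g hg i k => ?_⟩
  have hW : 0 ≤ W := (abs_nonneg _).trans (hg i k)
  have hp : 0 < M.dx ^ a := Real.rpow_pos_of_pos (M.dx_pos hY) a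
  have hgn : ‖g‖ ≤ W :=
    (pi_norm_le_iff_of_nonneg hW).2 fun i => (pi_norm_le_iff_of_nonneg hW).2 fun k => hg i k
  calc |LD M g i k| ≤ ‖LD M g i‖ := norm_le_pi_norm (LD M g i) k
    _ ≤ ‖LD M g‖ := norm_le_pi_norm (LD M g) i
    _ ≤ ‖(LD M).toContinuousLinearMap‖ * ‖g‖ := (LD M).toContinuousLinearMap.le_opNorm g
    _ ≤ ‖(LD M).toContinuousLinearMap‖ * W := by gcongr
    _ ≤ D * M.dx ^ a := (div_le_iff₀ hp).1 (hD ⟨M, hM, rfl⟩)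

/-- Bound at the interior nodes: consistency on fine meshes, finiteness on coarse ones. -/
theorem exists_interior_bound {σ a : ℝ} (hY : 0 < Y) {LD : DiscreteOp X Y}
    {reg : ((Fin N → ℝ) → ℝ → ℝ) → ℝ≥0∞} (hLD : HasOrder σ LD a reg) (R : ℝ≥0) (W : ℝ) :
    ∃ C : ℝ, 0 ≤ C ∧ ∀ v, reg v ≤ R → (∀ p ∈ domain X Y, extOp σ v p.1 p.2 = 0) →
      (∀ x ∈ closedBase X, ∀ y ∈ Icc 0 Y, |v x y| ≤ W) →
      ∀ (M : Mesh X Y) i k, M.Interior i k → |LD M (M.restrict v) i k| ≤ C * M.dx ^ a := by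
  obtain ⟨C, δ, hδ, hC⟩ := hLD R
  obtain ⟨D, hD⟩ := exists_bound_coarse_mesh hY LD a W hδ
  refine ⟨max (max C D) 0, le_max_right _ _, fun v hv hv0 hvW M i k hik => ?_⟩
  have hp : 0 ≤ M.dx ^ a := (Real.rpow_pos_of_pos (M.dx_pos hY) a).le
  rcases lt_or_ge M.dx δ with h | h
  · have := hC v hv M h i k hik
    rw [hv0 _ ((M.mem_domain_iff hY i k).2 hik), sub_zero] at this
    exact this.trans (by gcongr; exact (le_max_left _ _).trans (le_max_left _ _))
  · have := hD M h (M.restrict v)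
      (fun i k => hvW _ (M.xNode_mem_closedBase hY i) _ (M.yNode_mem_Icc hY k)) i k
    exact this.trans (by gcongr; exact (le_max_right _ _).trans (le_max_left _ _))


/-! ### Behaviour of the solution at the base -/

/-- The `x` part of `L_σ` is `y^{1-σ}` times the Laplacian in `x`. -/
theorem extOp_eq (σ : ℝ) (v : (Fin N → ℝ) → ℝ → ℝ) (x : Fin N → ℝ) (y : ℝ) :
    extOp σ v x y = y ^ (1 - σ) * ∑ n, partialX n (partialX n v) x y
      + partialY (fun x' y' => y' ^ (1 - σ) * partialY v x' y') x y := by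
  unfold extOp
  rw [Finset.mul_sum]
  congr 1
  refine Finset.sum_congr rfl fun n _ => ?_
  exact deriv_const_mul_field _

/-- A classical solution of `L_σ v = 0` with bounded second derivatives in `x` behaves at the base
like `v(x, 0) + (∂v/∂y^σ) y^σ / ν_σ`, up to `O(y²)`. -/
theorem abs_sub_hasSigmaDeriv_le {σ B d : ℝ} (hσ : σ ∈ Ioo (0 : ℝ) 2) (hY : 0 < Y)
    {v : (Fin N → ℝ) → ℝ → ℝ} {x : Fin N → ℝ} (hx : x ∈ openBase X)
    (hcont : ContinuousOn (v x) (Icc 0 Y))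
    (hdiff : ContDiffOn ℝ 2 (fun p : (Fin N → ℝ) × ℝ => v p.1 p.2) (domain X Y))
    (hext : ∀ p ∈ domain X Y, extOp σ v p.1 p.2 = 0)
    (hB : ∀ p ∈ domain X Y, ∀ n, |partialX n (partialX n v) p.1 p.2| ≤ B)
    (hd : HasSigmaDeriv σ v x d) {y : ℝ} (hy : y ∈ Ioc 0 Y) :
    |nuSigma σ * (v x y - v x 0) - d * y ^ σ|
      ≤ nuSigma σ * (N * B / (2 * (2 - σ))) * y ^ 2 := by
  have hμ := muSigma_pos hσ
  have hν : 0 < nuSigma σ := mul_pos hσ.1 hμ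
  have hmem : ∀ y ∈ Ioo 0 Y, (x, y) ∈ domain X Y := fun y hy => ⟨hx, hy⟩
  have hφ2 : ContDiffOn ℝ 2 (v x) (Ioo 0 Y) :=
    hdiff.comp (f := fun s : ℝ => (x, s)) (by fun_prop) hmem
  have hφ : ∀ y ∈ Ioo 0 Y, HasDerivAt (v x) (partialY v x y) y := fun y hy =>
    ((hφ2.differentiableOn (by norm_num)).differentiableAt (isOpen_Ioo.mem_nhds hy)).hasDerivAt
  have hφ' : ∀ y ∈ Ioo 0 Y, DifferentiableAt ℝ (partialY v x) y := fun y hy =>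
    ((hφ2.deriv_of_isOpen isOpen_Ioo (m := 1) (by norm_num)).differentiableOn
      (by norm_num)).differentiableAt (isOpen_Ioo.mem_nhds hy)
  have hψ : ∀ y ∈ Ioo 0 Y, HasDerivAt (fun s => s ^ (1 - σ) * partialY v x s)
      (partialY (fun x' y' => y' ^ (1 - σ) * partialY v x' y') x y) y := fun y hy =>
    ((Real.differentiableAt_rpow_const_of_ne _ hy.1.ne').mul (hφ' y hy)).hasDerivAt
  have hle : ∀ y ∈ Ioo 0 Y, |partialY (fun x' y' => y' ^ (1 - σ) * partialY v x' y') x y|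
      ≤ N * B * y ^ (1 - σ) := by
    intro y hy
    have h0 := hext _ (hmem y hy)
    rw [extOp_eq] at h0
    have hp : 0 < y ^ (1 - σ) := Real.rpow_pos_of_pos hy.1 _
    -- The equation trades the `y` derivative of the flux for the Laplacian in `x`, which is
    -- bounded.
    rw [eq_neg_of_add_eq_zero_right h0, abs_neg, abs_mul, abs_of_pos hp, mul_comm]
    gcongr
    calc |∑ n, partialX n (partialX n v) x y| ≤ ∑ n, |partialX n (partialX n v) x y| :=
          Finset.abs_sum_le_sum_abs _ _
      _ ≤ ∑ _n : Fin N, B := Finset.sum_le_sum fun n _ => hB _ (hmem y hy) n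
      _ = N * B := by simp
  have hlim : Tendsto (fun s => s ^ (1 - σ) * partialY v x s) (𝓝[>] 0) (𝓝 (d / muSigma σ)) := by
    have := Tendsto.div_const hd (muSigma σ)
    refine this.congr fun s => ?_
    field_simp
  have h := abs_sub_sigma_expansion_le hσ hY hcont hφ hψ hle hlim hy
  have hσ0 : σ ≠ 0 := hσ.1.ne'
  have e : nuSigma σ * (v x y - v x 0) - d * y ^ σ
      = nuSigma σ * (v x y - v x 0 - d / muSigma σ * (y ^ σ / σ)) := by
    unfold nuSigma
    field_simp
  rw [e, abs_mul, abs_of_pos hν, mul_assoc]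
  gcongr

variable {T σ m : ℝ} {f : (Fin N → ℝ) → ℝ} {w : (Fin N → ℝ) → ℝ → ℝ → ℝ}

theorem openBase_subset_closedBase : openBase X ⊆ closedBase X :=
  Set.pi_mono fun _ _ => Ioo_subset_Icc_self

theorem IsSolution.continuousOn_y (hw : IsSolution X Y T σ m f w) {x : Fin N → ℝ}
    (hx : x ∈ closedBase X) {t : ℝ} (ht : t ∈ Icc 0 T) :
    ContinuousOn (fun y => w x y t) (Icc 0 Y) :=
  hw.continuousOn.comp (f := fun y => (x, y, t)) (by fun_prop) fun _ hy => ⟨hx, hy, ht⟩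

theorem IsSolution.continuousOn_t (hw : IsSolution X Y T σ m f w) {x : Fin N → ℝ}
    (hx : x ∈ closedBase X) {y : ℝ} (hy : y ∈ Icc 0 Y) :
    ContinuousOn (fun t => w x y t) (Icc 0 T) :=
  hw.continuousOn.comp (f := fun t => (x, y, t)) (by fun_prop) fun _ ht => ⟨hx, hy, ht⟩

/-- The increment of `w` near the base, compared with the time derivative of `w^{1/m}`, uniformly
up to the initial time. -/
theorem IsSolution.abs_increment_sub_derivWithin_le (hw : IsSolution X Y T σ m f w)
    (hsmooth : IsSmooth X Y T m w) (hσ : σ ∈ Ioo (0 : ℝ) 2) (hY : 0 < Y) (hT : 0 < T) {B : ℝ}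
    (hB : ∀ t ∈ Ioc 0 T, ∀ p ∈ domain X Y, ∀ n,
      |partialX n (partialX n fun x y => w x y t) p.1 p.2| ≤ B)
    {x : Fin N → ℝ} (hx : x ∈ openBase X) {y : ℝ} (hy : y ∈ Ioc 0 Y) {t : ℝ}
    (ht : t ∈ Icc 0 T) :
    |nuSigma σ * (w x y t - w x 0 t)
        - derivWithin (fun s => w x 0 s ^ (1 / m)) (Icc 0 T) t * y ^ σ|
      ≤ nuSigma σ * (N * B / (2 * (2 - σ))) * y ^ 2 := by
  have hxc := openBase_subset_closedBase hx
  have hU : UniqueDiffOn ℝ (Icc 0 T) := uniqueDiffOn_Icc hT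
  have hpos : ∀ t ∈ Ioc 0 T, |nuSigma σ * (w x y t - w x 0 t)
        - derivWithin (fun s => w x 0 s ^ (1 / m)) (Icc 0 T) t * y ^ σ|
      ≤ nuSigma σ * (N * B / (2 * (2 - σ))) * y ^ 2 := by
    intro t ht
    obtain ⟨d, hd, hsig⟩ := hw.evolution t ht x hxc
    rw [hd.derivWithin (hU t (Ioc_subset_Icc_self ht))]
    exact abs_sub_hasSigmaDeriv_le (v := fun x y => w x y t) hσ hY hx
      (hw.continuousOn_y hxc (Ioc_subset_Icc_self ht)) (hw.contDiffOn t ht)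
      (hw.extension t ht) (hB t ht) hsig hy
  -- The step `j = 0` uses `t = 0`, where the equations are not assumed. The bound does not depend
  -- on `t`, so it passes to the limit by continuity.
  rcases ht.1.eq_or_lt with rfl | h
  · have h0 : (0 : ℝ) ∈ Icc 0 T := left_mem_Icc.2 hT.le
    have hu : ContinuousOn (derivWithin (fun s => w x 0 s ^ (1 / m)) (Icc 0 T)) (Icc 0 T) :=
      (hsmooth.time_contDiffOn x hxc).continuousOn_derivWithin hU (by norm_num)
    have hc : ContinuousOn (fun t => |nuSigma σ * (w x y t - w x 0 t)
        - derivWithin (fun s => w x 0 s ^ (1 / m)) (Icc 0 T) t * y ^ σ|) (Icc 0 T) :=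
      ((((hw.continuousOn_t hxc (Ioc_subset_Icc_self hy)).sub
        (hw.continuousOn_t hxc (left_mem_Icc.2 hY.le))).const_mul _).sub
          (hu.mul continuousOn_const)).abs
    refine le_of_tendsto
      ((hc 0 h0).mono_of_mem_nhdsWithin (s := Ioi 0) (Icc_mem_nhdsGT hT)).tendsto ?_
    filter_upwards [Ioc_mem_nhdsGT hT] with s hs using hpos s hs
  · exact hpos t ⟨h, ht.2⟩

/-- A solution vanishes on the edges of the base as well as on the rest of the lateral boundary. -/
theorem IsSolution.eq_zero_of_notMem (hw : IsSolution X Y T σ m f w) (hX : ∀ n, 0 < X n)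
    (hY : 0 < Y) {x : Fin N → ℝ} (hx : x ∈ closedBase X) {y : ℝ} (hy : y ∈ Icc 0 Y)
    {t : ℝ} (ht : t ∈ Icc 0 T) (h : x ∉ openBase X ∨ y = Y) : w x y t = 0 := by
  have hpos : ∀ y ∈ Ioc 0 Y, (x ∉ openBase X ∨ y = Y) → w x y t = 0 := by
    intro y hy h
    refine hw.lateral t ht (x, y) ⟨?_, fun hb => hy.1.ne' hb.2⟩
    rw [isOpen_domain.frontier_eq, closure_domain hX hY]
    refine ⟨⟨hx, Ioc_subset_Icc_self hy⟩, fun hd => ?_⟩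
    rcases h with h | h
    · exact h hd.1
    · exact hd.2.2.ne h
  -- Edges of the base belong to `Γ_d`, not `Γ_h`, so the zero value is inherited from `y → 0⁺`.
  rcases hy.1.eq_or_lt with rfl | h0
  · have hx' : x ∉ openBase X := h.resolve_right hY.ne
    have hc := ((hw.continuousOn_y hx ht 0 hy).mono_of_mem_nhdsWithin (s := Ioi 0)
      (Icc_mem_nhdsGT hY)).tendsto
    refine tendsto_nhds_unique hc (tendsto_const_nhds.congr' ?_)
    filter_upwards [Ioc_mem_nhdsGT hY] with s hs using (hpos s hs (Or.inl hx')).symm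
  · exact hpos y ⟨h0, hy.2⟩ h

/-- Bound for the truncation error at the base nodes. -/
theorem IsSolution.exists_base_bound (hw : IsSolution X Y T σ m f w)
    (hsmooth : IsSmooth X Y T m w) (hσ : σ ∈ Ioo (0 : ℝ) 2) (hY : 0 < Y) (hT : 0 < T) :
    ∃ C : ℝ, 0 ≤ C ∧ ∀ x ∈ openBase X, ∀ y ∈ Ioc 0 Y, ∀ s t, 0 ≤ s → s ≤ t → t ≤ T →
      |nuSigma σ * ((t - s) / y ^ σ) * (w x y s - w x 0 s) + w x 0 s ^ (1 / m)
          - w x 0 t ^ (1 / m)| ≤ C * ((t - s) * (y ^ (2 - σ) + (t - s))) := by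
  obtain ⟨B, hB⟩ := hsmooth.space_bound
  obtain ⟨B', hB'⟩ := hsmooth.time_bound
  refine ⟨max (max (nuSigma σ * (N * B / (2 * (2 - σ)))) B') 0, le_max_right _ _, ?_⟩
  intro x hx y hy s t hs hst ht
  have hxc := openBase_subset_closedBase hx
  have h1 := hw.abs_increment_sub_derivWithin_le hsmooth hσ hY hT hB hx hy
    (t := s) ⟨hs, hst.trans ht⟩
  have h2 := abs_taylor_one_le hT (hsmooth.time_contDiffOn x hxc) (hB' x hxc) hs hst ht
  set A := nuSigma σ * (N * B / (2 * (2 - σ)))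
  set d := derivWithin (fun s => w x 0 s ^ (1 / m)) (Icc 0 T) s
  have hp : 0 < y ^ σ := Real.rpow_pos_of_pos hy.1 σ
  have hts : 0 ≤ t - s := sub_nonneg.2 hst
  have hy2 : y ^ 2 / y ^ σ = y ^ (2 - σ) := by
    rw [Real.rpow_sub hy.1, Real.rpow_two]
  -- Adding and subtracting `(t - s) * d` splits the error into a spatial and a temporal part.
  have e : nuSigma σ * ((t - s) / y ^ σ) * (w x y s - w x 0 s) + w x 0 s ^ (1 / m)
          - w x 0 t ^ (1 / m)
      = (t - s) / y ^ σ * (nuSigma σ * (w x y s - w x 0 s) - d * y ^ σ)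
        - (w x 0 t ^ (1 / m) - w x 0 s ^ (1 / m) - (t - s) * d) := by
    field_simp
    ring
  have hq : 0 ≤ (t - s) / y ^ σ := by positivity
  have hr : 0 ≤ y ^ (2 - σ) := Real.rpow_nonneg hy.1.le _
  rw [e]
  calc |(t - s) / y ^ σ * (nuSigma σ * (w x y s - w x 0 s) - d * y ^ σ)
        - (w x 0 t ^ (1 / m) - w x 0 s ^ (1 / m) - (t - s) * d)|
      ≤ (t - s) / y ^ σ * |nuSigma σ * (w x y s - w x 0 s) - d * y ^ σ|
        + |w x 0 t ^ (1 / m) - w x 0 s ^ (1 / m) - (t - s) * d| := by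
        refine (abs_sub _ _).trans_eq ?_
        rw [abs_mul, abs_of_nonneg hq]
    _ ≤ (t - s) / y ^ σ * (A * y ^ 2) + B' * (t - s) ^ 2 := by gcongr
    _ = A * ((t - s) * y ^ (2 - σ)) + B' * (t - s) ^ 2 := by rw [← hy2]; ring
    _ ≤ max (max A B') 0 * ((t - s) * y ^ (2 - σ)) + max (max A B') 0 * (t - s) ^ 2 := by
        gcongr
        · exact (le_max_left _ _).trans (le_max_left _ _)
        · exact (le_max_right _ _).trans (le_max_left _ _)
    _ = max (max A B') 0 * ((t - s) * (y ^ (2 - σ) + (t - s))) := by ring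

end FracPME

/-! ### Combining the three kinds of nodes -/

theorem mainTheorem2 {N : ℕ} (X : Fin N → ℝ) (Y T σ m a : ℝ)
    (hX : ∀ n, 0 < X n) (hY : 0 < Y) (hT : 0 < T)
    (hσ : σ ∈ Set.Ioo (0 : ℝ) 2) (hm : 1 ≤ m)
    (f : (Fin N → ℝ) → ℝ) (hf : ∀ x ∈ FracPME.closedBase X, 0 ≤ f x)
    (w : (Fin N → ℝ) → ℝ → ℝ → ℝ)
    (hw : FracPME.IsSolution X Y T σ m f w)
    (hsmooth : FracPME.IsSmooth X Y T m w)
    (LD : FracPME.DiscreteOp X Y)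
    (reg : ((Fin N → ℝ) → ℝ → ℝ) → ENNReal)
    (hLD : FracPME.HasOrder σ LD a reg)
    (hreg : ∃ R : NNReal, ∀ t ∈ Set.Ioc 0 T, reg (fun x y => w x y t) ≤ R) :
    ∃ C : ℝ, 0 < C ∧ ∀ (M : FracPME.Mesh X Y) (J : ℕ) [NeZero J],
      FracPME.maxTruncError T σ m LD w M J ≤
        C * (FracPME.dt T J * (M.dx ^ (2 - σ) + FracPME.dt T J) + M.dx ^ a) := by
  obtain ⟨R, hR⟩ := hreg
  obtain ⟨W, hW⟩ : ∃ W, ∀ p ∈ FracPME.closedBase X ×ˢ Icc 0 Y ×ˢ Icc 0 T,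
      ‖w p.1 p.2.1 p.2.2‖ ≤ W :=
    ((isCompact_univ_pi fun _ => isCompact_Icc).prod
      (isCompact_Icc.prod isCompact_Icc)).exists_bound_of_continuousOn hw.continuousOn
  obtain ⟨C₁, hC₁, hint⟩ := FracPME.exists_interior_bound hY hLD R W
  obtain ⟨C₂, hC₂, hbase⟩ := hw.exists_base_bound hsmooth hσ hY hT
  -- The `+ 1` only makes the constant strictly positive.
  refine ⟨C₁ + C₂ + 1, by positivity, fun M J _ => Finset.sup'_le _ _ ?_⟩
  rintro ⟨i, k, j⟩ -
  have hdx := M.dx_pos hY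
  have hJ : (0 : ℝ) < J := Nat.cast_pos.2 (NeZero.pos J)
  have hdt : 0 < FracPME.dt T J := div_pos hT hJ
  have hJT : (J : ℝ) * FracPME.dt T J = T := by
    unfold FracPME.dt
    field_simp
  have ht1 : ((j + 1 : ℕ) : ℝ) * FracPME.dt T J ∈ Ioc 0 T := by
    refine ⟨by positivity, le_of_le_of_eq ?_ hJT⟩
    gcongr
    exact j.2
  have hE1 : 0 ≤ M.dx ^ a := Real.rpow_nonneg hdx.le a
  have hE2 : 0 ≤ FracPME.dt T J * (M.dx ^ (2 - σ) + FracPME.dt T J) :=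
    mul_nonneg hdt.le (add_nonneg (Real.rpow_nonneg hdx.le _) hdt.le)
  have hE1' := mul_nonneg hC₁ hE1
  have hE2' := mul_nonneg hC₂ hE2
  have hE12 := mul_nonneg hC₁ hE2
  have hE21 := mul_nonneg hC₂ hE1
  have hxc := M.xNode_mem_closedBase hY i
  have hyc := M.yNode_mem_Icc hY k
  simp only [FracPME.truncError]
  split_ifs with h h'
  · have := hint _ (hR _ ht1) (hw.extension _ ht1)
      (fun x hx y hy => hW (x, y, _) ⟨hx, hy, Ioc_subset_Icc_self ht1⟩) M i k h
    linarith
  · have hx := (M.xNode_mem_openBase_iff hY i).2 h'.1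
    have hstep : ((j + 1 : ℕ) : ℝ) * FracPME.dt T J - (j : ℕ) * FracPME.dt T J
        = FracPME.dt T J := by
      push_cast
      ring
    have := hbase _ hx M.dx ⟨hdx, M.dx_le hY⟩ ((j : ℕ) * FracPME.dt T J)
      ((j + 1 : ℕ) * FracPME.dt T J) (by positivity) (by linarith) ht1.2
    rw [hstep] at this
    have hy1 : M.yNode 1 = M.dx := by simp [FracPME.Mesh.yNode]
    have hy0 : M.yNode 0 = 0 := by simp [FracPME.Mesh.yNode]
    rw [hy1, hy0]
    linarith
  -- A node that is neither interior nor an inner base node has `x_i` on the boundary of the base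
  -- box or `k = K`.
  · have hbd : M.xNode i ∉ FracPME.openBase X ∨ M.yNode k = Y := by
      by_cases hi : M.XInterior i
      · right
        have hk0 : (k : ℕ) ≠ 0 := fun hk => h' ⟨hi, hk⟩
        have hkK : (k : ℕ) = M.K := by
          have h1 : ¬ (k : ℕ) < M.K := fun hk => h ⟨hi, Nat.pos_of_ne_zero hk0, hk⟩
          have h2 := k.2
          omega
        unfold FracPME.Mesh.yNode
        rw [hkK]
        exact M.K_mul_dx
      · exact Or.inl fun hx => hi ((M.xNode_mem_openBase_iff hY i).1 hx)
    rw [hw.eq_zero_of_notMem hX hY hxc hyc (Ioc_subset_Icc_self ht1) hbd, abs_zero]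
    positivity
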